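/- Let $d\ge 2$. Call $\mathbf v\in\mathbb Z_{\ge 0}^d$ primitive if the greatest common divisor of its coordinates is $1$, and let $d(\mathbf v)$ be the number of its non-zero coordinates. Let $$Zon_d(\mathbf x)=\prod_{\mathbf v\in\mathbb Z_{\ge0}^d\text{ primitive}}\bigl(1-\mathbf x^{\mathbf v}\bigr)^{-2^{d(\mathbf v)-1}},\qquad \mathbf x^{\mathbf v}=\prod_{i=1}^d x_i^{v_i},$$ be the generating function of lattice zonotopes, and write $e^{-\boldsymbol\theta}=(e^{-\theta_1},\dots,e^{-\theta_d})$. For every $\boldsymbol\theta\in(0,\infty)^d$ the product $Zon_d(e^{-\boldsymbol\theta})$ converges, and $\boldsymbol\theta\mapsto\log Zon_d(e^{-\boldsymbol\theta})$ is infinitely differentiable on $(0,\infty)^d$. Moreover, for all integers $k_1,\dots,k_d\ge 0$ and every $\epsilon>1$, $$\frac{\partial^{k_1+\cdots+k_d}}{\partial\theta_1^{k_1}\cdots\partial\theta_d^{k_d}}\log Zon_d(e^{-\boldsymbol\theta})\;\sim\;(-1)^{k_1+\cdots+k_d}\,\frac{2^{d-1}\zeta(d+1)}{\zeta(d)}\,\frac{\prod_{i=1}^d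 k_i!}{\prod_{i=1}^d\theta_i^{k_i+1}}$$ as $\boldsymbol\theta\to\mathbf 0$ within the set of $\boldsymbol\theta\in(0,\infty)^d$ such that $\theta_i/\theta_j\in(1/\epsilon,\epsilon)$ for all $i\ne j$, where $\zeta$ is the Riemann zeta function. -/

import Mathlib

open scoped ContDiff

namespace LatticeZonotope

/-- The primitive vectors of `ℤ₊^d`: nonnegative integer vectors whose coordinates have greatest
common divisor `1` (the zero vector has gcd `0` and is not primitive). -/
def primitiveVectors (d : ℕ) : Set (Fin d → ℕ) :=
  {v | Finset.univ.gcd v = 1}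

/-- The number `d(v)` of nonzero coordinates of `v`. -/
def numNonzero {d : ℕ} (v : Fin d → ℕ) : ℕ :=
  (Finset.univ.filter fun i => v i ≠ 0).card

/-- The factor `(1 - x^v)^{-2^{d(v)-1}}`, where `x^v = ∏ i, x_i^{v_i}`. For a primitive `v` one has
`d(v) ≥ 1`, so the subtraction in the exponent does not truncate. -/
noncomputable def zonFactor {d : ℕ} (x : Fin d → ℝ) (v : Fin d → ℕ) : ℝ :=
  ((1 - ∏ i, x i ^ v i) ^ (2 ^ (numNonzero v - 1)))⁻¹

/-- The generating function of lattice zonotopes,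
`Zon_d(x) = ∏_v (1 - x^v)^{-2^{d(v)-1}}`, the product being over the primitive `v ∈ ℤ₊^d`. -/
noncomputable def Zon (d : ℕ) (x : Fin d → ℝ) : ℝ :=
  ∏' v : primitiveVectors d, zonFactor x v

/-- The function `θ ↦ log Zon_d(e^{-θ})`, where `e^{-θ} = (e^{-θ_1}, …, e^{-θ_d})`. -/
noncomputable def logZonExp (d : ℕ) (θ : Fin d → ℝ) : ℝ :=
  Real.log (Zon d fun i => Real.exp (-θ i))

/-- The partial derivative `∂f/∂θ_i`. -/
noncomputable def partialDeriv {d : ℕ} (i : Fin d) (f : (Fin d → ℝ) → ℝ) : (Fin d → ℝ) → ℝ :=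
  fun θ => lineDeriv ℝ f θ (Pi.single i 1)

/-- The iterated partial derivative `∂^{k_1+⋯+k_d} f / ∂θ_1^{k_1} ⋯ ∂θ_d^{k_d}`. -/
noncomputable def mixedPartial {d : ℕ} (k : Fin d → ℕ) (f : (Fin d → ℝ) → ℝ) : (Fin d → ℝ) → ℝ :=
  (List.finRange d).foldr (fun i g => (partialDeriv i)^[k i] g) f

/-- The open orthant `(0, ∞)^d`. -/
def positiveOrthant (d : ℕ) : Set (Fin d → ℝ) :=
  {θ | ∀ i, 0 < θ i}

/-- The cone of those `θ ∈ (0, ∞)^d` all of whose ratios `θ_i / θ_j`, `i ≠ j`, lie in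
`(1/ε, ε)`. -/
def ratioCone (d : ℕ) (ε : ℝ) : Set (Fin d → ℝ) :=
  {θ | θ ∈ positiveOrthant d ∧ ∀ i j, i ≠ j → θ i / θ j ∈ Set.Ioo (1 / ε) ε}

end LatticeZonotope

namespace LatticeZonotope

open Filter Topology

/-! ### One-variable series -/

/-! Expanding `-log (1 - x) = ∑ x^m / m` for each primitive `v` and writing `w = m v` turns `log
Zon_d(e^{-θ})` into a sum over nonzero `w` of `2^{d(w)-1} / gcd(w) · e^{-w·θ}` (`logZonExp_eq`).
Each derivative acts termwise and only inserts a factor `-w_i`.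

Fix `k` and normalise by `N(θ) = ∏ θ_i^{k_i+1}`. Let `T`, `P`, `L` be `N(θ)` times the sum of `w^k
e^{-w·θ}` with weight `2^{d(w)-1}` over all nonzero `w`, with the same weight over primitive `w`,
and with weight `2^{d(w)-1} / gcd(w)`. Since `2^{d(w)}` is a product over coordinates, `2T` is, up
to the `w = 0` term, a product of one-variable series, and `T → A = 2^{d-1} ∏ k_i!`.

As `N(mθ) = m^{|k|+d} N(θ)`, grouping by gcd gives `T(θ) = ∑ m^{-d} P(mθ)` and `L(θ) = ∑ m^{-d-1}
P(mθ)`. Möbius inversion and dominated convergence yield `P → A / ζ(d)`, then `L → A ζ(d+1) / ζ(d)`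
(`tendsto_tsum_smul_of_tendsto`). Domination needs `T` bounded on the whole cone, not only near `0`;
this is the only place where comparability of the `θ_i` enters (`exists_bound_ratioCone`). -/

theorem exp_neg_lt_one {t : ℝ} (ht : 0 < t) : Real.exp (-t) < 1 :=
  Real.exp_lt_one_iff.2 (by linarith)

theorem norm_exp_neg_lt_one {t : ℝ} (ht : 0 < t) : ‖Real.exp (-t)‖ < 1 := by
  rw [Real.norm_eq_abs, Real.abs_exp]
  exact exp_neg_lt_one ht

theorem summable_pow_mul_exp (k : ℕ) {t : ℝ} (ht : 0 < t) :
    Summable fun n : ℕ => (n : ℝ) ^ k * Real.exp (-(n * t)) := by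
  refine (summable_pow_mul_geometric_of_norm_lt_one k (norm_exp_neg_lt_one ht)).congr fun n => ?_
  rw [← Real.exp_nat_mul, mul_neg]

/-- Termwise `n^k ≤ (n+1)⋯(n+k) = k! · C(n+k, k)`, and the series of these binomials against
`e^{-nt}` has a closed form. -/
theorem tsum_pow_mul_exp_le (k : ℕ) {t : ℝ} (ht : 0 < t) :
    ∑' n : ℕ, (n : ℝ) ^ k * Real.exp (-(n * t)) ≤
      k.factorial * (1 / (1 - Real.exp (-t)) ^ (k + 1)) := by
  have h := (hasSum_choose_mul_geometric_of_norm_lt_one k (norm_exp_neg_lt_one ht)).mul_left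
    (k.factorial : ℝ)
  refine hasSum_le (fun n => ?_) (summable_pow_mul_exp k ht).hasSum h
  rw [← Real.exp_nat_mul, mul_neg, ← mul_assoc]
  gcongr
  have h1 : n ^ k ≤ k.factorial * (n + k).choose k := by
    rw [← Nat.ascFactorial_eq_factorial_mul_choose]
    exact (Nat.pow_le_pow_left n.le_succ k).trans (Nat.pow_succ_le_ascFactorial (n + 1) k)
  exact_mod_cast h1

/-- The same binomial series is compared with the terms of index `n + k`, through `k! · C(n+k, k) ≤
(n+k)^k`. The shift costs the factor `e^{-kt}`, which tends to `1` as `t → 0`. -/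
theorem le_tsum_pow_mul_exp (k : ℕ) {t : ℝ} (ht : 0 < t) :
    Real.exp (-(k * t)) * (k.factorial * (1 / (1 - Real.exp (-t)) ^ (k + 1))) ≤
      ∑' n : ℕ, (n : ℝ) ^ k * Real.exp (-(n * t)) := by
  have h := ((hasSum_choose_mul_geometric_of_norm_lt_one k (norm_exp_neg_lt_one ht)).mul_left
    (k.factorial : ℝ)).mul_left (Real.exp (-(k * t)))
  rw [← h.tsum_eq]
  have hs := summable_pow_mul_exp k ht
  have hle := tsum_comp_le_tsum_of_inj hs (fun n => by positivity) (add_left_injective k)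
  refine le_trans (Summable.tsum_le_tsum (fun n => ?_) h.summable
    (hs.comp_injective (add_left_injective k))) hle
  have h1 : k.factorial * (n + k).choose k ≤ (n + k) ^ k := by
    rw [← Nat.descFactorial_eq_factorial_mul_choose]
    exact Nat.descFactorial_le_pow _ _
  have h2 : (k.factorial : ℝ) * (n + k).choose k ≤ ((n + k : ℕ) : ℝ) ^ k := by exact_mod_cast h1
  calc Real.exp (-(k * t)) * (k.factorial * ((n + k).choose k * Real.exp (-t) ^ n))
      = (k.factorial * (n + k).choose k) * Real.exp (-((n + k : ℕ) * t)) := by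
        have : -(((n + k : ℕ) : ℝ) * t) = -(k * t) + n * (-t) := by push_cast; ring
        rw [this, Real.exp_add, Real.exp_nat_mul]; ring
    _ ≤ _ := mul_le_mul_of_nonneg_right h2 (Real.exp_pos _).le

/-- The weighted moment series `∑ (1 or 2) n^k e^{-nt}`, the weight being `1` at `n = 0` only. -/
noncomputable def momentSeries (k : ℕ) (t : ℝ) : ℝ :=
  ∑' n : ℕ, (if n ≠ 0 then 2 else 1) * ((n : ℝ) ^ k * Real.exp (-(n * t)))

theorem summable_momentSeries (k : ℕ) {t : ℝ} (ht : 0 < t) :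
    Summable fun n : ℕ => (if n ≠ 0 then 2 else 1) * ((n : ℝ) ^ k * Real.exp (-(n * t))) := by
  refine ((summable_pow_mul_exp k ht).mul_left 2).of_nonneg_of_le (fun n => ?_) fun n => ?_
  · split_ifs <;> positivity
  · gcongr
    split_ifs <;> norm_num

theorem momentSeries_nonneg (k : ℕ) (t : ℝ) : 0 ≤ momentSeries k t :=
  tsum_nonneg fun n => by split_ifs <;> positivity

theorem momentSeries_le (k : ℕ) {t : ℝ} (ht : 0 < t) :
    momentSeries k t ≤ 2 * ∑' n : ℕ, (n : ℝ) ^ k * Real.exp (-(n * t)) := by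
  rw [← tsum_mul_left]
  refine (summable_momentSeries k ht).tsum_le_tsum (fun n => ?_)
    ((summable_pow_mul_exp k ht).mul_left 2)
  gcongr
  split_ifs <;> norm_num

theorem le_momentSeries (k : ℕ) {t : ℝ} (ht : 0 < t) :
    2 * (∑' n : ℕ, (n : ℝ) ^ k * Real.exp (-(n * t))) - 1 ≤ momentSeries k t := by
  rw [← tsum_mul_left, sub_le_iff_le_add]
  -- Doubling every term overcounts only at `n = 0`, where `0^k` is at most `1`.
  have h1 : HasSum (fun n : ℕ => if n = 0 then (1 : ℝ) else 0) 1 := hasSum_ite_eq 0 1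
  refine hasSum_le (fun n => ?_) ((summable_pow_mul_exp k ht).mul_left 2).hasSum
    ((summable_momentSeries k ht).hasSum.add h1)
  rcases eq_or_ne n 0 with rfl | hn
  · rcases eq_or_ne k 0 with rfl | hk
    · norm_num
    · simp [hk]
  · simp [hn]

theorem tendsto_div_one_sub_exp_neg :
    Tendsto (fun t : ℝ => t / (1 - Real.exp (-t))) (𝓝[>] 0) (𝓝 1) := by
  have h : HasDerivAt (fun t : ℝ => 1 - Real.exp (-t)) 1 0 := by
    have := ((hasDerivAt_neg (0 : ℝ)).exp).const_sub 1
    simpa using this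
  have h2 := (hasDerivAt_iff_tendsto_slope.1 h).mono_left
    (nhdsWithin_mono 0 (fun x (hx : 0 < x) => ne_of_gt hx))
  have h3 := h2.inv₀ one_ne_zero
  rw [inv_one] at h3
  refine h3.congr fun t => ?_
  simp [slope_def_field]

theorem div_one_sub_exp_neg_le {t : ℝ} (ht : 0 < t) : t / (1 - Real.exp (-t)) ≤ 1 + t := by
  have h1 : Real.exp (-t) < 1 := exp_neg_lt_one ht
  rw [div_le_iff₀ (by linarith)]
  have h2 : (1 + t) * Real.exp (-t) ≤ 1 := by
    rw [Real.exp_neg, ← div_eq_mul_inv, div_le_one (Real.exp_pos t)]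
    linarith [Real.add_one_le_exp t]
  linarith

/-- Valid for every `t > 0`, with polynomial growth at infinity, which an exponential factor later
absorbs. -/
theorem pow_mul_momentSeries_le (k : ℕ) {t : ℝ} (ht : 0 < t) :
    t ^ (k + 1) * momentSeries k t ≤ 2 * k.factorial * (1 + t) ^ (k + 1) := by
  have h1 : Real.exp (-t) < 1 := exp_neg_lt_one ht
  calc t ^ (k + 1) * momentSeries k t
      ≤ t ^ (k + 1) * (2 * (k.factorial * (1 / (1 - Real.exp (-t)) ^ (k + 1)))) := by
        gcongr
        exact (momentSeries_le k ht).trans (by gcongr; exact tsum_pow_mul_exp_le k ht)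
    _ = 2 * k.factorial * (t / (1 - Real.exp (-t))) ^ (k + 1) := by rw [div_pow]; ring
    _ ≤ _ := by
        have := div_nonneg ht.le (sub_nonneg.2 h1.le)
        gcongr
        exact div_one_sub_exp_neg_le ht

theorem tendsto_pow_mul_momentSeries (k : ℕ) :
    Tendsto (fun t : ℝ => t ^ (k + 1) * momentSeries k t) (𝓝[>] 0) (𝓝 (2 * k.factorial)) := by
  have hq := (tendsto_div_one_sub_exp_neg.pow (k + 1)).const_mul (2 * k.factorial : ℝ)
  rw [one_pow, mul_one] at hq
  have hid : Tendsto (fun t : ℝ => t) (𝓝[>] 0) (𝓝 0) := nhdsWithin_le_nhds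
  have hexp : Tendsto (fun t : ℝ => Real.exp (-(k * t))) (𝓝[>] 0) (𝓝 1) := by
    have : Continuous fun t : ℝ => Real.exp (-(k * t)) := by fun_prop
    simpa using (this.tendsto 0).mono_left (nhdsWithin_le_nhds (s := Set.Ioi 0))
  -- The subtracted power of `t` comes from the `-1` in `le_momentSeries` and vanishes in the limit.
  have hlow := (hexp.mul hq).sub (hid.pow (k + 1))
  simp only [ne_eq, Nat.add_eq_zero_iff, one_ne_zero, and_false, not_false_eq_true, zero_pow,
    one_mul, sub_zero] at hlow
  refine tendsto_of_tendsto_of_tendsto_of_le_of_le' hlow hq ?_ ?_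
  · filter_upwards [self_mem_nhdsWithin] with t (ht : 0 < t)
    have h := le_tsum_pow_mul_exp k ht
    have h2 := le_momentSeries k ht
    calc _ = t ^ (k + 1) * (2 * (Real.exp (-(k * t)) *
            (k.factorial * (1 / (1 - Real.exp (-t)) ^ (k + 1)))) - 1) := by
          rw [div_pow]; ring
      _ ≤ _ := by gcongr; linarith
  · filter_upwards [self_mem_nhdsWithin] with t (ht : 0 < t)
    have h := tsum_pow_mul_exp_le k ht
    have h2 := momentSeries_le k ht
    calc t ^ (k + 1) * momentSeries k t
        ≤ t ^ (k + 1) * (2 * (k.factorial * (1 / (1 - Real.exp (-t)) ^ (k + 1)))) := by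
          gcongr; linarith
      _ = _ := by rw [div_pow]; ring

/-! ### Sums of products over `Fin d → α` -/

theorem hasSum_prod_fin {α : Type*} {d : ℕ} {f : Fin d → α → ℝ} (h0 : ∀ i a, 0 ≤ f i a)
    (hf : ∀ i, Summable (f i)) :
    HasSum (fun u : Fin d → α => ∏ i, f i (u i)) (∏ i, ∑' a, f i a) := by
  induction d with
  | zero =>
    simp [hasSum_unique]
  | succ d ih =>
    have h1 := ih (f := fun i => f i.succ) (fun i => h0 i.succ) fun i => hf i.succ
    have h3 : Summable fun x : α × (Fin d → α) => f 0 x.1 * ∏ i, f (Fin.succ i) (x.2 i) :=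
      Summable.mul_of_nonneg (g := fun u : Fin d → α => ∏ i, f (Fin.succ i) (u i)) (hf 0)
        h1.summable (h0 0) fun u => Finset.prod_nonneg fun i _ => h0 _ _
    have h2 := (hf 0).hasSum.mul h1 h3
    rw [Fin.prod_univ_succ, ← (Fin.consEquiv fun _ => α).hasSum_iff]
    refine Eq.subst (motive := fun F => HasSum F _) (funext fun x => ?_) h2
    simp [Fin.prod_univ_succ, Fin.consEquiv]

/-! ### Möbius inversion and dominated convergence for dilation averages -/

theorem sum_divisorsAntidiagonal_moebius (n : ℕ) :
    ∑ x ∈ n.divisorsAntidiagonal, (ArithmeticFunction.moebius x.1 : ℝ) = if n = 1 then 1 else 0 := by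
  have h : (ArithmeticFunction.moebius * ArithmeticFunction.zeta : ArithmeticFunction ℝ) n =
      (1 : ArithmeticFunction ℝ) n := by rw [ArithmeticFunction.coe_moebius_mul_coe_zeta]
  rw [ArithmeticFunction.coe_mul_zeta_apply, ArithmeticFunction.one_apply] at h
  rw [← h, Nat.sum_divisorsAntidiagonal (f := fun x _ => (ArithmeticFunction.moebius x : ℝ))]
  rfl

theorem summable_pnat_inv_pow {e : ℕ} (he : 1 < e) : Summable fun n : ℕ+ => ((n : ℝ) ^ e)⁻¹ :=
  (Real.summable_nat_pow_inv.2 he).comp_injective PNat.coe_injective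

theorem abs_moebius_le_one_real (n : ℕ) : |(ArithmeticFunction.moebius n : ℝ)| ≤ 1 := by
  exact_mod_cast ArithmeticFunction.abs_moebius_le_one (n := n)

/-- Möbius inversion for bounded sequences weighted by `n⁻ᵉ`. -/
theorem tsum_moebius_mul_tsum {e : ℕ} (he : 1 < e) {a : ℕ+ → ℝ} {C : ℝ} (ha : ∀ n, |a n| ≤ C) :
    ∑' n : ℕ+, (ArithmeticFunction.moebius n * ((n : ℝ) ^ e)⁻¹) *
      ∑' m : ℕ+, ((m : ℝ) ^ e)⁻¹ * a (m * n) = a 1 := by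
  have hC : 0 ≤ C := (abs_nonneg _).trans (ha 1)
  let g : ℕ+ × ℕ+ → ℝ := fun x => (ArithmeticFunction.moebius x.1 * ((x.1 : ℝ) ^ e)⁻¹) *
    (((x.2 : ℝ) ^ e)⁻¹ * a (x.2 * x.1))
  have hz := summable_pnat_inv_pow he
  have hzz := (hz.mul_of_nonneg hz (fun n => by positivity) fun n => by positivity).mul_right C
  have hg : Summable g := by
    refine Summable.of_norm_bounded hzz fun x => ?_
    simp only [g, Real.norm_eq_abs, abs_mul, abs_inv, abs_pow, Nat.abs_cast]
    have h1 := abs_moebius_le_one_real x.1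
    have h2 := ha (x.2 * x.1)
    calc _ ≤ (1 * ((x.1 : ℝ) ^ e)⁻¹) * (((x.2 : ℝ) ^ e)⁻¹ * C) := by gcongr
      _ = _ := by ring
  have h1 : ∑' x, g x = ∑' n : ℕ+, (ArithmeticFunction.moebius n * ((n : ℝ) ^ e)⁻¹) *
      ∑' m : ℕ+, ((m : ℝ) ^ e)⁻¹ * a (m * n) := by
    rw [hg.tsum_prod' fun n => hg.comp_injective (Prod.mk_right_injective n)]
    simp only [g, tsum_mul_left]
  -- The absolutely convergent double sum is regrouped by the product `N = n m`. The weights combine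
  -- to `N⁻ᵉ`, and `∑ μ` over the divisors of `N` leaves only `N = 1`.
  rw [← h1, ← sigmaAntidiagonalEquivProd.tsum_eq]
  have hs : Summable fun c => g (sigmaAntidiagonalEquivProd c) :=
    sigmaAntidiagonalEquivProd.summable_iff.2 hg
  rw [Summable.tsum_sigma' (fun n => (hasSum_fintype _).summable) hs]
  have key : ∀ N : ℕ+, ∑' c : (N : ℕ).divisorsAntidiagonal, g (sigmaAntidiagonalEquivProd ⟨N, c⟩) =
      if N = 1 then a 1 else 0 := by
    intro N
    have : ∀ c : (N : ℕ).divisorsAntidiagonal, g (sigmaAntidiagonalEquivProd ⟨N, c⟩) =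
        (ArithmeticFunction.moebius c.1.1 : ℝ) * (((N : ℝ) ^ e)⁻¹ * a N) := by
      intro c
      have hc : c.1.1 * c.1.2 = N := (Nat.mem_divisorsAntidiagonal.1 c.2).1
      have e1 : (((sigmaAntidiagonalEquivProd ⟨N, c⟩).1 : ℕ+) : ℕ) = c.1.1 := rfl
      have e2 : (((sigmaAntidiagonalEquivProd ⟨N, c⟩).2 : ℕ+) : ℕ) = c.1.2 := rfl
      have e3 : (sigmaAntidiagonalEquivProd ⟨N, c⟩).2 * (sigmaAntidiagonalEquivProd ⟨N, c⟩).1 = N := by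
        apply PNat.eq
        rw [PNat.mul_coe, e1, e2, mul_comm, hc]
      simp only [g]
      have e4 : (N : ℝ) = c.1.1 * c.1.2 := by exact_mod_cast hc.symm
      rw [e3, e1, e2, e4, mul_pow, mul_inv]
      ring
    simp only [this, tsum_mul_right]
    rw [Finset.tsum_subtype (N : ℕ).divisorsAntidiagonal
      fun c => (ArithmeticFunction.moebius c.1 : ℝ), sum_divisorsAntidiagonal_moebius]
    by_cases hN : N = 1
    · subst hN; simp
    · simp [hN]
  simp only [key, tsum_ite_eq]

theorem tsum_pnat_inv_pow_pos {e : ℕ} (he : 1 < e) : 0 < ∑' n : ℕ+, ((n : ℝ) ^ e)⁻¹ :=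
  (summable_pnat_inv_pow he).tsum_pos (fun n => by positivity) 1 (by simp)

theorem tsum_moebius_mul_inv_pow {e : ℕ} (he : 1 < e) :
    ∑' n : ℕ+, (ArithmeticFunction.moebius n * ((n : ℝ) ^ e)⁻¹) =
      (∑' n : ℕ+, ((n : ℝ) ^ e)⁻¹)⁻¹ := by
  have h := tsum_moebius_mul_tsum he (a := fun _ => 1) (C := 1) (by simp)
  simp only [mul_one, tsum_mul_right] at h
  exact eq_inv_of_mul_eq_one_left h

theorem riemannZeta_re_eq_tsum_pnat {e : ℕ} (he : 1 < e) :
    (riemannZeta (e : ℂ)).re = ∑' n : ℕ+, ((n : ℝ) ^ e)⁻¹ := by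
  have h : riemannZeta (e : ℂ) = ((∑' n : ℕ, ((n : ℝ) ^ e)⁻¹ : ℝ) : ℂ) := by
    rw [zeta_nat_eq_tsum_of_gt_one he]
    push_cast
    simp
  rw [h, Complex.ofReal_re, tsum_pnat_eq_tsum_succ (f := fun n : ℕ => ((n : ℝ) ^ e)⁻¹),
    (Real.summable_nat_pow_inv.2 he).tsum_eq_zero_add]
  -- The extra term at index `0` is `(0 ^ e)⁻¹ = 0`.
  simp [show e ≠ 0 by omega]

section DilationAverages

variable {E : Type*} [AddCommGroup E] [TopologicalSpace E] [Module ℝ E] [ContinuousSMul ℝ E]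

theorem tendsto_smul_nhdsWithin_zero {K : Set E} (hK : ∀ n : ℕ+, ∀ x ∈ K, (n : ℝ) • x ∈ K)
    (n : ℕ+) : Tendsto (fun x : E => (n : ℝ) • x) (𝓝[K] 0) (𝓝[K] 0) := by
  refine tendsto_nhdsWithin_iff.2 ⟨?_, eventually_nhdsWithin_of_forall (hK n)⟩
  have : Continuous fun x : E => (n : ℝ) • x := by fun_prop
  simpa using (this.tendsto 0).mono_left (nhdsWithin_le_nhds (s := K))

/-- Each dilation preserves the filter at `0` in `K`, so every term converges. The bound on `g` is
required on all of `K`, since the points `n x` leave any bounded set. -/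
theorem tendsto_tsum_smul {K : Set E} (hK : ∀ n : ℕ+, ∀ x ∈ K, (n : ℝ) • x ∈ K) {g : E → ℝ}
    {C A : ℝ} (hg : ∀ x ∈ K, |g x| ≤ C) (hA : Tendsto g (𝓝[K] 0) (𝓝 A)) {a : ℕ+ → ℝ}
    (ha : Summable a) :
    Tendsto (fun x => ∑' n : ℕ+, a n * g ((n : ℝ) • x)) (𝓝[K] 0) (𝓝 ((∑' n, a n) * A)) := by
  rw [← tsum_mul_right]
  refine tendsto_tsum_of_dominated_convergence (ha.norm.mul_right C)
    (fun n => (hA.comp (tendsto_smul_nhdsWithin_zero hK n)).const_mul (a n)) ?_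
  filter_upwards [self_mem_nhdsWithin] with x hx n
  rw [norm_mul]
  exact mul_le_mul_of_nonneg_left (hg _ (hK n x hx)) (norm_nonneg _)

/-- If `t x = ∑ m⁻ᵉ p (m x)` on a cone, where `p` is bounded, and `t → A` at `0`, then
`∑ m⁻ᵉ⁻¹ p (m x)` tends to `A ζ(e+1) / ζ(e)`. -/
theorem tendsto_tsum_smul_of_tendsto {K : Set E} (hK : ∀ n : ℕ+, ∀ x ∈ K, (n : ℝ) • x ∈ K) {e : ℕ}
    (he : 1 < e) {p t : E → ℝ} {C A : ℝ} (hp : ∀ x ∈ K, |p x| ≤ C)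
    (ht : ∀ x ∈ K, t x = ∑' m : ℕ+, ((m : ℝ) ^ e)⁻¹ * p ((m : ℝ) • x))
    (hA : Tendsto t (𝓝[K] 0) (𝓝 A)) :
    Tendsto (fun x => ∑' m : ℕ+, ((m : ℝ) ^ (e + 1))⁻¹ * p ((m : ℝ) • x)) (𝓝[K] 0)
      (𝓝 ((riemannZeta ((e : ℂ) + 1)).re / (riemannZeta (e : ℂ)).re * A)) := by
  have hz := summable_pnat_inv_pow he
  have htb : ∀ x ∈ K, |t x| ≤ (∑' m : ℕ+, ((m : ℝ) ^ e)⁻¹) * C := by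
    intro x hx
    rw [ht x hx, ← tsum_mul_right, ← Real.norm_eq_abs]
    refine tsum_of_norm_bounded (hz.mul_right C).hasSum fun m => ?_
    rw [norm_mul, Real.norm_of_nonneg (by positivity)]
    exact mul_le_mul_of_nonneg_left (hp _ (hK m x hx)) (by positivity)
  have hmu : Summable fun n : ℕ+ => (ArithmeticFunction.moebius n * ((n : ℝ) ^ e)⁻¹ : ℝ) := by
    refine Summable.of_norm_bounded hz fun n => ?_
    rw [norm_mul, Real.norm_of_nonneg (r := ((n : ℝ) ^ e)⁻¹) (by positivity)]
    exact mul_le_of_le_one_left (by positivity) (abs_moebius_le_one_real n)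
  have hpl := tendsto_tsum_smul hK htb hA hmu
  -- Möbius inversion recovers `p x = ∑ μ(n) n⁻ᵉ t(n x)`, so the limit of `t` passes to `p`.
  have hpl' : Tendsto p (𝓝[K] 0) (𝓝 ((riemannZeta (e : ℂ)).re⁻¹ * A)) := by
    rw [riemannZeta_re_eq_tsum_pnat he, ← tsum_moebius_mul_inv_pow he]
    refine hpl.congr' ?_
    filter_upwards [self_mem_nhdsWithin] with x hx
    have := tsum_moebius_mul_tsum he (a := fun n => p ((n : ℝ) • x)) (C := C)
      fun n => hp _ (hK n x hx)
    simp only [PNat.one_coe, Nat.cast_one, one_smul] at this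
    rw [← this]
    refine tsum_congr fun n => ?_
    rw [ht _ (hK n x hx)]
    simp only [smul_smul, PNat.mul_coe, Nat.cast_mul]
  have hfin := tendsto_tsum_smul hK hp hpl' (summable_pnat_inv_pow (e := e + 1) (by omega))
  rw [← riemannZeta_re_eq_tsum_pnat (e := e + 1) (by omega)] at hfin
  push_cast at hfin
  rwa [← mul_assoc, ← div_eq_mul_inv] at hfin

end DilationAverages

variable {d : ℕ}

/-! ### Multivariate exponential series -/

/-- The monomial-exponential term `w^k e^{-w·θ}`. -/
noncomputable def expTerm (k : Fin d → ℕ) (θ : Fin d → ℝ) (w : Fin d → ℕ) : ℝ :=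
  ∏ i, ((w i : ℝ) ^ k i * Real.exp (-(w i * θ i)))

/-- The series `∑_w c(w) w^k e^{-w·θ}` over `w ∈ ℕ^d`. -/
noncomputable def expSeries (c : (Fin d → ℕ) → ℝ) (k : Fin d → ℕ) (θ : Fin d → ℝ) : ℝ :=
  ∑' w, c w * expTerm k θ w

theorem expTerm_nonneg (k : Fin d → ℕ) (θ : Fin d → ℝ) (w : Fin d → ℕ) : 0 ≤ expTerm k θ w :=
  Finset.prod_nonneg fun i _ => by positivity

theorem expTerm_eq (k : Fin d → ℕ) (θ : Fin d → ℝ) (w : Fin d → ℕ) :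
    expTerm k θ w = (∏ i, (w i : ℝ) ^ k i) * Real.exp (-∑ i, w i * θ i) := by
  rw [expTerm, Finset.prod_mul_distrib, ← Real.exp_sum, Finset.sum_neg_distrib]

theorem expTerm_add_single (k : Fin d → ℕ) (θ : Fin d → ℝ) (w : Fin d → ℕ) (i : Fin d) :
    expTerm (k + Pi.single i 1) θ w = w i * expTerm k θ w := by
  have h : ∏ j, (w j : ℝ) ^ (Pi.single i 1 : Fin d → ℕ) j = w i := by
    rw [Finset.prod_eq_single i] <;> simp +contextual
  simp only [expTerm_eq, Pi.add_apply, pow_add, Finset.prod_mul_distrib, h]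
  ring

theorem expTerm_le_of_le (k : Fin d → ℕ) {θ θ' : Fin d → ℝ} (h : ∀ i, θ i ≤ θ' i)
    (w : Fin d → ℕ) : expTerm k θ' w ≤ expTerm k θ w := by
  refine Finset.prod_le_prod (fun i _ => by positivity) fun i _ => ?_
  have := h i
  gcongr

theorem expTerm_smul_vec (k : Fin d → ℕ) (θ : Fin d → ℝ) (m : ℕ) (w : Fin d → ℕ) :
    expTerm k θ (fun i => m * w i) = (m : ℝ) ^ (∑ i, k i) * expTerm k ((m : ℝ) • θ) w := by
  rw [expTerm, expTerm, ← Finset.prod_pow_eq_pow_sum, ← Finset.prod_mul_distrib]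
  refine Finset.prod_congr rfl fun i _ => ?_
  rw [Nat.cast_mul, mul_pow, mul_assoc, Pi.smul_apply, smul_eq_mul]
  congr 4
  ring

theorem summable_expTerm (k : Fin d → ℕ) {θ : Fin d → ℝ} (hθ : θ ∈ positiveOrthant d) :
    Summable (expTerm k θ) :=
  (hasSum_prod_fin (f := fun i (n : ℕ) => (n : ℝ) ^ k i * Real.exp (-(n * θ i)))
    (fun i n => by positivity) fun i => summable_pow_mul_exp (k i) (hθ i)).summable

theorem summable_mul_expTerm {c : (Fin d → ℕ) → ℝ} {C : ℝ} (hc : ∀ w, |c w| ≤ C)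
    (k : Fin d → ℕ) {θ : Fin d → ℝ} (hθ : θ ∈ positiveOrthant d) :
    Summable fun w => c w * expTerm k θ w := by
  refine Summable.of_norm_bounded ((summable_expTerm k hθ).mul_left C) fun w => ?_
  rw [norm_mul, Real.norm_of_nonneg (expTerm_nonneg k θ w)]
  exact mul_le_mul_of_nonneg_right (hc w) (expTerm_nonneg k θ w)

/-- The `i`-th coordinate as a continuous linear form on `ℝ^d`. -/
abbrev coordProj (i : Fin d) : (Fin d → ℝ) →L[ℝ] ℝ :=
  ContinuousLinearMap.proj i

theorem hasFDerivAt_expTerm (k : Fin d → ℕ) (w : Fin d → ℕ) (θ : Fin d → ℝ) :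
    HasFDerivAt (fun θ => expTerm k θ w)
      (∑ i, (-expTerm (k + Pi.single i 1) θ w) • coordProj i) θ := by
  simp only [expTerm_add_single]
  simp only [expTerm_eq]
  have h1 : HasFDerivAt (fun θ : Fin d → ℝ => -∑ i, (w i : ℝ) * θ i)
      (-∑ i, (w i : ℝ) • coordProj i) θ := by
    refine (HasFDerivAt.fun_sum fun i _ => ?_).neg
    exact (hasFDerivAt_apply i θ).const_mul (w i : ℝ)
  refine (h1.exp.const_mul (∏ i, (w i : ℝ) ^ k i)).congr_fderiv ?_
  ext v
  simp only [smul_apply, neg_apply,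
    sum_apply, ContinuousLinearMap.proj_apply, smul_eq_mul, neg_mul,
    Finset.sum_neg_distrib, mul_neg, Finset.mul_sum]
  congr 1
  exact Finset.sum_congr rfl fun i _ => by ring

theorem isOpen_positiveOrthant (d : ℕ) : IsOpen (positiveOrthant d) := by
  simp only [positiveOrthant, Set.ofPred_forall]
  exact isOpen_iInter_of_finite fun i => isOpen_lt continuous_const (continuous_apply i)

/-- The terms decrease in each `θ_i`. On the box where all coordinates exceed some `δ > 0` below
those of `θ`, their derivatives are therefore dominated by summable values at `(δ, …, δ)`. -/
theorem hasFDerivAt_expSeries {c : (Fin d → ℕ) → ℝ} {C : ℝ} (hc : ∀ w, |c w| ≤ C)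
    (k : Fin d → ℕ) {θ : Fin d → ℝ} (hθ : θ ∈ positiveOrthant d) :
    HasFDerivAt (expSeries c k)
      (∑ i, (-expSeries c (k + Pi.single i 1) θ) • coordProj i) θ := by
  obtain ⟨δ, hδ, hδθ⟩ : ∃ δ : ℝ, 0 < δ ∧ ∀ i, δ < θ i := by
    have h : ∀ᶠ δ in 𝓝[>] (0 : ℝ), ∀ i, δ < θ i :=
      eventually_all.2 fun i => nhdsWithin_le_nhds (Iio_mem_nhds (hθ i))
    obtain ⟨δ, h, hδ⟩ := (h.and self_mem_nhdsWithin).exists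
    exact ⟨δ, hδ, h⟩
  have hC : 0 ≤ C := (abs_nonneg _).trans (hc 0)
  have hδ' : (fun _ => δ) ∈ positiveOrthant d := fun _ => hδ
  let s : Set (Fin d → ℝ) := Set.univ.pi fun _ => Set.Ioi δ
  have hs : IsOpen s := isOpen_set_pi Set.finite_univ fun _ _ => isOpen_Ioi
  have hs' : IsPreconnected s := (convex_pi fun _ _ => convex_Ioi δ).isPreconnected
  have hθs : θ ∈ s := fun i _ => hδθ i
  have hu : Summable fun w => C * ∑ i, expTerm (k + Pi.single i 1) (fun _ => δ) w :=
    (summable_sum fun i _ => summable_expTerm (k + Pi.single i 1) hδ').mul_left C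
  have h := hasFDerivAt_tsum_of_isPreconnected (f := fun w θ => c w * expTerm k θ w)
    (f' := fun w θ => c w • ∑ i, (-expTerm (k + Pi.single i 1) θ w) •
      coordProj i) hu hs hs'
    (fun w x _ => (hasFDerivAt_expTerm k w x).const_mul (c w)) (fun w x hx => ?_) hθs
    (summable_mul_expTerm hc k hθ) hθs
  · refine h.congr_fderiv (HasSum.tsum_eq ?_)
    simp only [Finset.smul_sum]
    refine hasSum_sum fun i _ => ?_
    have hi := ((summable_mul_expTerm hc (k + Pi.single i 1) hθ).hasSum.neg).smul_const
      (coordProj i)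
    refine Eq.subst (motive := fun F => HasSum F _) (funext fun w => ?_) hi
    rw [smul_smul, mul_neg]
  · rw [norm_smul]
    refine mul_le_mul (hc w) ((norm_sum_le _ _).trans (Finset.sum_le_sum fun i _ => ?_))
      (norm_nonneg _) hC
    rw [norm_smul, norm_neg, Real.norm_of_nonneg (expTerm_nonneg _ _ _)]
    have h1 : ‖coordProj i‖ ≤ 1 :=
      ContinuousLinearMap.opNorm_le_bound _ zero_le_one fun v => by
        simpa using norm_le_pi_norm v i
    refine (mul_le_of_le_one_right (expTerm_nonneg _ _ _) h1).trans
      (expTerm_le_of_le _ (fun j => ?_) w)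
    exact (hx j trivial).le

/-- The components of the derivative are again series of this family, with `k` raised by one unit,
so induction over all `k` applies. -/
theorem contDiffOn_expSeries {c : (Fin d → ℕ) → ℝ} {C : ℝ} (hc : ∀ w, |c w| ≤ C)
    (k : Fin d → ℕ) : ContDiffOn ℝ ∞ (expSeries c k) (positiveOrthant d) := by
  refine contDiffOn_infty.2 fun n => ?_
  induction n generalizing k with
  | zero =>
    exact contDiffOn_zero.2 fun θ hθ =>
      (hasFDerivAt_expSeries hc k hθ).continuousAt.continuousWithinAt
  | succ n ih =>
    rw [Nat.cast_add, Nat.cast_one, contDiffOn_succ_iff_fderiv_of_isOpen (isOpen_positiveOrthant d)]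
    refine ⟨fun θ hθ => (hasFDerivAt_expSeries hc k hθ).differentiableAt.differentiableWithinAt,
      fun h => by simp at h, ?_⟩
    refine ContDiffOn.congr (f := fun θ => ∑ i, (-expSeries c (k + Pi.single i 1) θ) •
      coordProj i) ?_ fun θ hθ => (hasFDerivAt_expSeries hc k hθ).fderiv
    exact ContDiffOn.sum fun i _ => (ih _).neg.smul contDiffOn_const

theorem partialDeriv_eq_of_eqOn {c : (Fin d → ℕ) → ℝ} {C : ℝ} (hc : ∀ w, |c w| ≤ C)
    {k : Fin d → ℕ} {f : (Fin d → ℝ) → ℝ} {a : ℝ}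
    (hf : Set.EqOn f (fun θ => a * expSeries c k θ) (positiveOrthant d)) (i : Fin d) :
    Set.EqOn (partialDeriv i f) (fun θ => -a * expSeries c (k + Pi.single i 1) θ)
      (positiveOrthant d) := by
  intro θ hθ
  have he : f =ᶠ[𝓝 θ] fun θ => a * expSeries c k θ :=
    hf.eventuallyEq_of_mem ((isOpen_positiveOrthant d).mem_nhds hθ)
  have h := (((hasFDerivAt_expSeries hc k hθ).const_mul a).congr_of_eventuallyEq he).hasLineDerivAt
    (Pi.single i 1)
  rw [partialDeriv, h.lineDeriv]
  simp [Pi.single_apply]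

theorem iterate_partialDeriv_eq_of_eqOn {c : (Fin d → ℕ) → ℝ} {C : ℝ} (hc : ∀ w, |c w| ≤ C)
    {k : Fin d → ℕ} {f : (Fin d → ℝ) → ℝ} {a : ℝ}
    (hf : Set.EqOn f (fun θ => a * expSeries c k θ) (positiveOrthant d)) (i : Fin d) (n : ℕ) :
    Set.EqOn ((partialDeriv i)^[n] f)
      (fun θ => (a * (-1) ^ n) * expSeries c (k + Pi.single i n) θ) (positiveOrthant d) := by
  induction n with
  | zero => simpa using hf
  | succ n ih =>
    rw [Function.iterate_succ_apply']
    have h := partialDeriv_eq_of_eqOn hc ih i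
    rw [add_assoc, ← Pi.single_add] at h
    convert h using 3
    ring

theorem mixedPartial_eq_of_eqOn {c : (Fin d → ℕ) → ℝ} {C : ℝ} (hc : ∀ w, |c w| ≤ C)
    {f : (Fin d → ℝ) → ℝ} (hf : Set.EqOn f (expSeries c 0) (positiveOrthant d))
    (k : Fin d → ℕ) :
    Set.EqOn (mixedPartial k f) (fun θ => (-1) ^ (∑ i, k i) * expSeries c k θ)
      (positiveOrthant d) := by
  -- Stated for arbitrary lists so that induction on the fold is possible.
  have h : ∀ l : List (Fin d), Set.EqOn (l.foldr (fun i g => (partialDeriv i)^[k i] g) f)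
      (fun θ => (-1) ^ (l.map k).sum * expSeries c (l.map fun i => Pi.single i (k i)).sum θ)
      (positiveOrthant d) := by
    intro l
    induction l with
    | nil => simpa using hf
    | cons i l ih =>
      have h := iterate_partialDeriv_eq_of_eqOn hc ih i (k i)
      simpa only [List.foldr_cons, List.map_cons, List.sum_cons, pow_add, add_comm, mul_comm]
        using h
  have h2 := h (List.finRange d)
  have e1 : ((List.finRange d).map k).sum = ∑ i, k i := by
    rw [Fin.sum_univ_def]
  have e2 : ((List.finRange d).map fun i => (Pi.single i (k i) : Fin d → ℕ)).sum = k := by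
    rw [← Fin.sum_univ_def, Finset.univ_sum_single]
  rwa [e1, e2] at h2

/-! ### Primitive vectors and their dilates -/

/-- The vector `m v` for a positive integer `m` and a primitive vector `v`. -/
def dilate (x : ℕ+ × primitiveVectors d) : Fin d → ℕ :=
  fun i => x.1 * x.2.1 i

theorem gcd_dilate (x : ℕ+ × primitiveVectors d) : Finset.univ.gcd (dilate x) = x.1 := by
  have h : Finset.univ.gcd x.2.1 = 1 := x.2.2
  unfold dilate
  rw [Finset.gcd_mul_left, h]
  simp

theorem dilate_injective : Function.Injective (dilate (d := d)) := by
  intro x y h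
  have h1 : x.1 = y.1 := PNat.coe_injective (by rw [← gcd_dilate x, ← gcd_dilate y, h])
  refine Prod.ext h1 (Subtype.ext (funext fun i => ?_))
  have h2 : (x.1 : ℕ) * x.2.1 i = y.1 * y.2.1 i := congrFun h i
  rw [h1] at h2
  exact Nat.eq_of_mul_eq_mul_left y.1.pos h2

theorem eq_zero_of_notMem_range_dilate {w : Fin d → ℕ} (hw : w ∉ Set.range (dilate (d := d))) :
    w = 0 := by
  by_contra h0
  obtain ⟨i, hi⟩ := Function.ne_iff.1 h0
  obtain ⟨v, hv, hv1⟩ := Finset.extract_gcd w ⟨i, Finset.mem_univ i⟩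
  have hg : 0 < Finset.univ.gcd w := Nat.pos_of_ne_zero fun h =>
    hi (Finset.gcd_eq_zero_iff.1 h i (Finset.mem_univ i))
  exact hw ⟨(⟨_, hg⟩, ⟨v, hv1⟩), funext fun j => (hv j (Finset.mem_univ j)).symm⟩

theorem gcd_zero_vec : Finset.univ.gcd (0 : Fin d → ℕ) = 0 :=
  Finset.gcd_eq_zero_iff.2 fun _ _ => rfl

theorem dilate_ne_zero (x : ℕ+ × primitiveVectors d) : dilate x ≠ 0 := by
  intro h
  have := gcd_dilate x
  rw [h, gcd_zero_vec] at this
  exact x.1.ne_zero this.symm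

theorem ne_zero_of_mem_primitiveVectors {v : Fin d → ℕ} (hv : v ∈ primitiveVectors d) : v ≠ 0 := by
  rintro rfl
  exact zero_ne_one (gcd_zero_vec.symm.trans hv)

theorem numNonzero_dilate (x : ℕ+ × primitiveVectors d) :
    numNonzero (dilate x) = numNonzero x.2.1 := by
  simp [numNonzero, dilate]

theorem numNonzero_le (w : Fin d → ℕ) : numNonzero w ≤ d :=
  (Finset.card_le_univ _).trans (by simp)

theorem two_pow_numNonzero_sub_one_le (w : Fin d → ℕ) :
    (2 : ℝ) ^ (numNonzero w - 1) ≤ 2 ^ d :=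
  pow_le_pow_right₀ one_le_two ((Nat.sub_le _ _).trans (numNonzero_le w))

theorem two_pow_numNonzero (w : Fin d → ℕ) :
    (2 : ℝ) ^ numNonzero w = ∏ i, if w i ≠ 0 then 2 else 1 := by
  rw [numNonzero, Finset.prod_ite]
  simp

theorem numNonzero_pos {w : Fin d → ℕ} (hw : w ≠ 0) : 0 < numNonzero w := by
  obtain ⟨i, hi⟩ := Function.ne_iff.1 hw
  exact Finset.card_pos.2 ⟨i, by simpa using hi⟩

/-- The weight `2^{d(w)-1}` on nonzero vectors. -/
noncomputable def nonzeroCoeff (w : Fin d → ℕ) : ℝ :=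
  if w = 0 then 0 else 2 ^ (numNonzero w - 1)

/-- The weight `2^{d(w)-1}` on primitive vectors. -/
noncomputable def primitiveCoeff : (Fin d → ℕ) → ℝ :=
  (primitiveVectors d).indicator fun w => 2 ^ (numNonzero w - 1)

/-- The coefficient `2^{d(w)-1} / gcd(w)` of `log Zon_d`; it vanishes at `w = 0`. -/
noncomputable def zonCoeff (w : Fin d → ℕ) : ℝ :=
  2 ^ (numNonzero w - 1) / (Finset.univ.gcd w : ℕ)

theorem nonzeroCoeff_nonneg (w : Fin d → ℕ) : 0 ≤ nonzeroCoeff w := by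
  unfold nonzeroCoeff
  split_ifs <;> positivity

theorem abs_nonzeroCoeff_le (w : Fin d → ℕ) : |nonzeroCoeff w| ≤ 2 ^ d := by
  rw [abs_of_nonneg (nonzeroCoeff_nonneg w), nonzeroCoeff]
  split_ifs
  · positivity
  · exact two_pow_numNonzero_sub_one_le w

theorem primitiveCoeff_nonneg (w : Fin d → ℕ) : 0 ≤ primitiveCoeff w :=
  Set.indicator_nonneg (fun _ _ => by positivity) w

theorem primitiveCoeff_le (w : Fin d → ℕ) : primitiveCoeff w ≤ nonzeroCoeff w := by
  by_cases hw : w ∈ primitiveVectors d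
  · rw [primitiveCoeff, Set.indicator_of_mem hw, nonzeroCoeff,
      if_neg (ne_zero_of_mem_primitiveVectors hw)]
  · rw [primitiveCoeff, Set.indicator_of_notMem hw]
    exact nonzeroCoeff_nonneg w

theorem abs_primitiveCoeff_le (w : Fin d → ℕ) : |primitiveCoeff w| ≤ 2 ^ d := by
  rw [abs_of_nonneg (primitiveCoeff_nonneg w)]
  exact (primitiveCoeff_le w).trans ((le_abs_self _).trans (abs_nonzeroCoeff_le w))

theorem abs_zonCoeff_le (w : Fin d → ℕ) : |zonCoeff w| ≤ 2 ^ d := by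
  rw [zonCoeff, abs_of_nonneg (by positivity)]
  rcases Nat.eq_zero_or_pos (Finset.univ.gcd w) with h | h
  · rw [h]; simp
  · exact (div_le_self (by positivity) (by exact_mod_cast h)).trans
      (two_pow_numNonzero_sub_one_le w)

theorem zonCoeff_zero : zonCoeff (0 : Fin d → ℕ) = 0 := by
  rw [zonCoeff, gcd_zero_vec]
  simp

theorem nonzeroCoeff_dilate (x : ℕ+ × primitiveVectors d) :
    nonzeroCoeff (dilate x) = 2 ^ (numNonzero x.2.1 - 1) := by
  rw [nonzeroCoeff, if_neg (dilate_ne_zero x), numNonzero_dilate]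

theorem zonCoeff_dilate (x : ℕ+ × primitiveVectors d) :
    zonCoeff (dilate x) = (x.1 : ℝ)⁻¹ * 2 ^ (numNonzero x.2.1 - 1) := by
  rw [zonCoeff, gcd_dilate, numNonzero_dilate, div_eq_inv_mul]

/-- Grouping the vectors by their greatest common divisor. -/
theorem expSeries_eq_tsum_primitive {c : (Fin d → ℕ) → ℝ} {C : ℝ} (hc : ∀ w, |c w| ≤ C)
    (hc0 : c 0 = 0) {b : ℕ+ → ℝ}
    (hb : ∀ x, c (dilate x) = b x.1 * 2 ^ (numNonzero x.2.1 - 1)) (k : Fin d → ℕ)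
    {θ : Fin d → ℝ} (hθ : θ ∈ positiveOrthant d) :
    expSeries c k θ =
      ∑' m : ℕ+, b m * (m : ℝ) ^ (∑ i, k i) * expSeries primitiveCoeff k ((m : ℝ) • θ) := by
  have hs := summable_mul_expTerm hc k hθ
  have h0 : ∀ w ∉ Set.range (dilate (d := d)), c w * expTerm k θ w = 0 := fun w hw => by
    rw [eq_zero_of_notMem_range_dilate hw, hc0, zero_mul]
  have h1 := (dilate_injective.hasSum_iff h0).2 hs.hasSum
  rw [expSeries, ← h1.tsum_eq, h1.summable.tsum_prod]
  refine tsum_congr fun m => ?_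
  have h2 : expSeries primitiveCoeff k ((m : ℝ) • θ) =
      ∑' v : primitiveVectors d, 2 ^ (numNonzero v.1 - 1) * expTerm k ((m : ℝ) • θ) v.1 := by
    rw [tsum_subtype (primitiveVectors d)
      fun v => 2 ^ (numNonzero v - 1) * expTerm k ((m : ℝ) • θ) v, expSeries]
    refine tsum_congr fun v => ?_
    rw [primitiveCoeff, Set.indicator_mul_left]
  rw [h2, ← tsum_mul_left]
  refine tsum_congr fun v => ?_
  have h3 : expTerm k θ (dilate (m, v)) =
      (m : ℝ) ^ (∑ i, k i) * expTerm k ((m : ℝ) • θ) v.1 := expTerm_smul_vec k θ m v.1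
  simp only [Function.comp_apply]
  rw [hb, h3]
  ring

/-! ### The logarithm of the generating function -/

theorem exp_neg_sum_lt_one {v : Fin d → ℕ} (hv : v ≠ 0) {θ : Fin d → ℝ}
    (hθ : θ ∈ positiveOrthant d) : Real.exp (-∑ i, v i * θ i) < 1 := by
  refine exp_neg_lt_one ?_
  obtain ⟨i, hi⟩ := Function.ne_iff.1 hv
  refine Finset.sum_pos' (fun j _ => mul_nonneg (Nat.cast_nonneg _) (hθ j).le)
    ⟨i, Finset.mem_univ i, mul_pos ?_ (hθ i)⟩
  exact_mod_cast Nat.pos_of_ne_zero hi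

theorem prod_exp_neg_pow (v : Fin d → ℕ) (θ : Fin d → ℝ) :
    ∏ i, Real.exp (-θ i) ^ v i = Real.exp (-∑ i, v i * θ i) := by
  rw [← Finset.sum_neg_distrib, Real.exp_sum]
  refine Finset.prod_congr rfl fun i _ => ?_
  rw [← Real.exp_nat_mul, mul_neg]

theorem zonFactor_exp_pos {v : Fin d → ℕ} (hv : v ≠ 0) {θ : Fin d → ℝ}
    (hθ : θ ∈ positiveOrthant d) : 0 < zonFactor (fun i => Real.exp (-θ i)) v := by
  rw [zonFactor, prod_exp_neg_pow]
  exact inv_pos.2 (pow_pos (sub_pos.2 (exp_neg_sum_lt_one hv hθ)) _)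

theorem hasSum_log_zonFactor (v : primitiveVectors d) {θ : Fin d → ℝ}
    (hθ : θ ∈ positiveOrthant d) :
    HasSum (fun m : ℕ+ => zonCoeff (dilate (m, v)) * expTerm 0 θ (dilate (m, v)))
      (Real.log (zonFactor (fun i => Real.exp (-θ i)) v.1)) := by
  have hx := exp_neg_sum_lt_one (ne_zero_of_mem_primitiveVectors v.2) hθ
  rw [zonFactor, prod_exp_neg_pow, Real.log_inv, Real.log_pow]
  set x := Real.exp (-∑ i, v.1 i * θ i) with hxdef
  have h := (Real.hasSum_pow_div_log_of_abs_lt_one (x := x)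
    (by rwa [abs_of_nonneg (Real.exp_pos _).le])).mul_left ((2 : ℝ) ^ (numNonzero v.1 - 1))
  -- The logarithm series is indexed from `0` with terms `x^(n+1) / (n+1)`; here `m = n + 1`.
  rw [← Equiv.pnatEquivNat.hasSum_iff] at h
  push_cast
  rw [← mul_neg]
  refine Eq.subst (motive := fun F => HasSum F _) (funext fun m => ?_) h
  have h3 : expTerm 0 θ (dilate (m, v)) = x ^ (m : ℕ) := by
    rw [expTerm_eq, hxdef, ← Real.exp_nat_mul]
    simp only [dilate, Pi.zero_apply, pow_zero, Finset.prod_const_one, one_mul, mul_neg,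
      Finset.mul_sum, Nat.cast_mul, mul_assoc]
  have h4 : m.natPred + 1 = (m : ℕ) := PNat.natPred_add_one m
  have h5 : (m.natPred : ℝ) + 1 = (m : ℕ) := by exact_mod_cast h4
  simp only [Function.comp_apply, Equiv.pnatEquivNat_apply]
  rw [h3, zonCoeff_dilate, h4, h5]
  ring

theorem hasSum_log_zonFactor_expSeries {θ : Fin d → ℝ} (hθ : θ ∈ positiveOrthant d) :
    HasSum (fun v : primitiveVectors d => Real.log (zonFactor (fun i => Real.exp (-θ i)) v.1))
      (expSeries zonCoeff 0 θ) := by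
  have h0 : ∀ w ∉ Set.range (dilate (d := d)), zonCoeff w * expTerm 0 θ w = 0 := fun w hw => by
    rw [eq_zero_of_notMem_range_dilate hw, zonCoeff_zero, zero_mul]
  have h1 := (dilate_injective.hasSum_iff h0).2 (summable_mul_expTerm abs_zonCoeff_le 0 hθ).hasSum
  have h2 := (Equiv.prodComm (primitiveVectors d) ℕ+).hasSum_iff.2 h1
  exact h2.prod_fiberwise fun v => hasSum_log_zonFactor v hθ

theorem multipliable_zonFactor {θ : Fin d → ℝ} (hθ : θ ∈ positiveOrthant d) :
    Multipliable fun v : primitiveVectors d => zonFactor (fun i => Real.exp (-θ i)) v.1 :=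
  Real.multipliable_of_summable_log
    (fun v => zonFactor_exp_pos (ne_zero_of_mem_primitiveVectors v.2) hθ)
    (hasSum_log_zonFactor_expSeries hθ).summable

theorem logZonExp_eq {θ : Fin d → ℝ} (hθ : θ ∈ positiveOrthant d) :
    logZonExp d θ = expSeries zonCoeff 0 θ := by
  have h := hasSum_log_zonFactor_expSeries hθ
  rw [logZonExp, Zon, ← Real.rexp_tsum_eq_tprod
    (fun v => zonFactor_exp_pos (ne_zero_of_mem_primitiveVectors v.2) hθ) h.summable,
    Real.log_exp, h.tsum_eq]

/-! ### Asymptotics of the series over all nonzero vectors -/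

/-- The normalising factor `∏ θ_i^{k_i+1}`. -/
noncomputable def normFactor (k : Fin d → ℕ) (θ : Fin d → ℝ) : ℝ :=
  ∏ i, θ i ^ (k i + 1)

theorem normFactor_pos (k : Fin d → ℕ) {θ : Fin d → ℝ} (hθ : θ ∈ positiveOrthant d) :
    0 < normFactor k θ :=
  Finset.prod_pos fun i _ => pow_pos (hθ i) _

theorem normFactor_smul (k : Fin d → ℕ) (θ : Fin d → ℝ) (a : ℝ) :
    normFactor k (a • θ) = a ^ (∑ i, k i + d) * normFactor k θ := by
  simp only [normFactor, Pi.smul_apply, smul_eq_mul, mul_pow, Finset.prod_mul_distrib]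
  rw [Finset.prod_pow_eq_pow_sum, Finset.sum_add_distrib]
  simp

theorem hasSum_two_pow_mul_expTerm (k : Fin d → ℕ) {θ : Fin d → ℝ}
    (hθ : θ ∈ positiveOrthant d) :
    HasSum (fun w => 2 ^ numNonzero w * expTerm k θ w) (∏ i, momentSeries (k i) (θ i)) := by
  have h := hasSum_prod_fin (f := fun i (n : ℕ) =>
      (if n ≠ 0 then 2 else 1) * ((n : ℝ) ^ k i * Real.exp (-(n * θ i))))
    (fun i n => by split_ifs <;> positivity) fun i => summable_momentSeries (k i) (hθ i)
  refine Eq.subst (motive := fun F => HasSum F _) (funext fun w => ?_) h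
  rw [two_pow_numNonzero, expTerm, ← Finset.prod_mul_distrib]

/-- The factor `2` turns `2^{d(w)-1}` into the multiplicative weight `2^{d(w)}`. The correction
removes `w = 0`, whose term is `1` if `k = 0` and `0` otherwise. -/
theorem two_mul_expSeries_nonzeroCoeff (k : Fin d → ℕ) {θ : Fin d → ℝ}
    (hθ : θ ∈ positiveOrthant d) :
    2 * expSeries nonzeroCoeff k θ =
      (∏ i, momentSeries (k i) (θ i)) - ∏ i, (0 : ℝ) ^ k i := by
  rw [expSeries, ← tsum_mul_left]
  refine HasSum.tsum_eq ?_
  have h1 : HasSum (fun w : Fin d → ℕ => if w = 0 then ∏ i, (0 : ℝ) ^ k i else 0) _ :=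
    hasSum_ite_eq 0 _
  refine Eq.subst (motive := fun F => HasSum F _) (funext fun w => ?_)
    ((hasSum_two_pow_mul_expTerm k hθ).sub h1)
  rcases eq_or_ne w 0 with rfl | hw
  · simp [nonzeroCoeff, expTerm, numNonzero]
  · rw [if_neg hw, nonzeroCoeff, if_neg hw, sub_zero, ← mul_assoc, ← pow_succ',
      Nat.sub_add_cancel (numNonzero_pos hw)]

theorem tendsto_normFactor_mul_expSeries {K : Set (Fin d → ℝ)} (hK : K ⊆ positiveOrthant d)
    (hd : d ≠ 0) (k : Fin d → ℕ) :
    Tendsto (fun θ => normFactor k θ * expSeries nonzeroCoeff k θ) (𝓝[K] 0)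
      (𝓝 (2 ^ (d - 1) * ∏ i, ((k i).factorial : ℝ))) := by
  have hi : ∀ i, Tendsto (fun θ : Fin d → ℝ => θ i) (𝓝[K] 0) (𝓝[>] 0) := fun i =>
    tendsto_nhdsWithin_iff.2 ⟨((continuous_apply i).tendsto' 0 0 rfl).mono_left
      nhdsWithin_le_nhds, eventually_nhdsWithin_of_forall fun θ hθ => hK hθ i⟩
  have h1 : Tendsto (fun θ : Fin d → ℝ => ∏ i, (θ i ^ (k i + 1) * momentSeries (k i) (θ i)))
      (𝓝[K] 0) (𝓝 (∏ i, (2 * ((k i).factorial : ℝ)))) :=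
    tendsto_finsetProd _ fun i _ => (tendsto_pow_mul_momentSeries (k i)).comp (hi i)
  have h2 : Tendsto (fun θ : Fin d → ℝ => normFactor k θ * ∏ i, (0 : ℝ) ^ k i) (𝓝[K] 0) (𝓝 0) := by
    have hc : Continuous fun θ : Fin d → ℝ => normFactor k θ * ∏ i, (0 : ℝ) ^ k i := by
      unfold normFactor; fun_prop
    refine (hc.tendsto' 0 0 ?_).mono_left nhdsWithin_le_nhds
    rw [normFactor, Finset.prod_eq_zero (Finset.mem_univ ⟨0, Nat.pos_of_ne_zero hd⟩) (by simp),
      zero_mul]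
  have h3 := (h1.sub h2).const_mul (1 / 2 : ℝ)
  have e : (1 / 2 : ℝ) * (∏ i, (2 * ((k i).factorial : ℝ)) - 0) =
      2 ^ (d - 1) * ∏ i, ((k i).factorial : ℝ) := by
    obtain ⟨n, rfl⟩ := Nat.exists_eq_succ_of_ne_zero hd
    rw [Finset.prod_mul_distrib, Finset.prod_const, Finset.card_univ, Fintype.card_fin, pow_succ]
    simp only [Nat.succ_eq_add_one, Nat.add_sub_cancel]
    ring
  rw [e] at h3
  refine h3.congr' ?_
  filter_upwards [self_mem_nhdsWithin] with θ hθ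
  have h4 := two_mul_expSeries_nonzeroCoeff k (hK hθ)
  rw [Finset.prod_mul_distrib, ← normFactor, ← mul_sub, ← h4]
  ring

/-- Half of the exponent is given up: `w·θ ≥ s` for `w ≠ 0`, so `e^{-w·θ} ≤ e^{-s/2} e^{-w·θ/2}`. -/
theorem expSeries_nonzeroCoeff_le (k : Fin d → ℕ) {θ : Fin d → ℝ} {s : ℝ} (hs : 0 < s)
    (hθ : ∀ i, s ≤ θ i) :
    expSeries nonzeroCoeff k θ ≤ Real.exp (-(s / 2)) * ∏ i, momentSeries (k i) (θ i / 2) := by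
  have hθ' : θ ∈ positiveOrthant d := fun i => hs.trans_le (hθ i)
  have hθ2 : (fun i => θ i / 2) ∈ positiveOrthant d := fun i => half_pos (hθ' i)
  refine hasSum_le (fun w => ?_) (summable_mul_expTerm abs_nonzeroCoeff_le k hθ').hasSum
    ((hasSum_two_pow_mul_expTerm k hθ2).mul_left _)
  rcases eq_or_ne w 0 with rfl | hw
  · rw [nonzeroCoeff, if_pos rfl, zero_mul]
    have := expTerm_nonneg k (fun i => θ i / 2) 0
    positivity
  · have h1 : nonzeroCoeff w ≤ 2 ^ numNonzero w := by
      rw [nonzeroCoeff, if_neg hw]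
      exact pow_le_pow_right₀ one_le_two (Nat.sub_le _ _)
    have h2 : expTerm k θ w ≤ Real.exp (-(s / 2)) * expTerm k (fun i => θ i / 2) w := by
      rw [expTerm_eq, expTerm_eq, mul_left_comm, ← Real.exp_add]
      gcongr
      obtain ⟨i, hi⟩ := Function.ne_iff.1 hw
      have h3 : s ≤ ∑ i, w i * θ i := by
        have hi1 : (1 : ℝ) ≤ w i := by exact_mod_cast Nat.pos_of_ne_zero hi
        calc s ≤ w i * θ i := by nlinarith [hθ i]
          _ ≤ _ := Finset.single_le_sum (f := fun i => (w i : ℝ) * θ i)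
            (fun j _ => mul_nonneg (Nat.cast_nonneg _) (hθ' j).le) (Finset.mem_univ i)
      have h4 : ∑ i, (w i : ℝ) * (θ i / 2) = (∑ i, w i * θ i) / 2 := by
        rw [Finset.sum_div]
        exact Finset.sum_congr rfl fun i _ => by ring
      rw [h4]
      linarith
    calc nonzeroCoeff w * expTerm k θ w
        ≤ 2 ^ numNonzero w * (Real.exp (-(s / 2)) * expTerm k (fun i => θ i / 2) w) :=
          mul_le_mul h1 h2 (expTerm_nonneg _ _ _) (by positivity)
      _ = _ := by ring

theorem exp_neg_half_mul_pow_le {b s : ℝ} (hb : 1 ≤ b) (hs : 0 ≤ s) (N : ℕ) :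
    Real.exp (-(s / 2)) * (1 + b * s) ^ N ≤ (2 * b) ^ N * N.factorial * Real.exp (1 / 2) := by
  -- The point `(1 + s) / 2` is chosen so that its exponential cancels `e^{-s/2}` up to the constant
  -- `e^{1/2}`.
  have h1 := Real.pow_div_factorial_le_exp ((1 + s) / 2) (by linarith) N
  rw [div_le_iff₀ (by positivity)] at h1
  have h2 : 1 + b * s ≤ (2 * b) * ((1 + s) / 2) := by linarith
  calc Real.exp (-(s / 2)) * (1 + b * s) ^ N
      ≤ Real.exp (-(s / 2)) * ((2 * b) * ((1 + s) / 2)) ^ N := by gcongr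
    _ = (2 * b) ^ N * Real.exp (-(s / 2)) * ((1 + s) / 2) ^ N := by rw [mul_pow]; ring
    _ ≤ (2 * b) ^ N * Real.exp (-(s / 2)) * (Real.exp ((1 + s) / 2) * N.factorial) := by gcongr
    _ = (2 * b) ^ N * N.factorial * (Real.exp (-(s / 2)) * Real.exp ((1 + s) / 2)) := by ring
    _ = _ := by rw [← Real.exp_add]; congr 2; ring

theorem exists_normFactor_mul_expSeries_le (k : Fin d → ℕ) {b : ℝ} (hb : 1 ≤ b) :
    ∃ C, ∀ (s : ℝ) (θ : Fin d → ℝ), 0 < s → (∀ i, s ≤ θ i ∧ θ i ≤ b * s) →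
      normFactor k θ * expSeries nonzeroCoeff k θ ≤ C := by
  set N := ∑ i, (k i + 1) with hN
  set A : ℝ := ∏ i, (2 ^ (k i + 1) * (2 * (k i).factorial)) with hA
  have hA0 : 0 ≤ A := Finset.prod_nonneg fun i _ => by positivity
  refine ⟨A * ((2 * b) ^ N * N.factorial * Real.exp (1 / 2)), fun s θ hs hθ => ?_⟩
  have hpos : θ ∈ positiveOrthant d := fun i => hs.trans_le (hθ i).1
  have h1 := expSeries_nonzeroCoeff_le k hs fun i => (hθ i).1
  have h2 : normFactor k θ * ∏ i, momentSeries (k i) (θ i / 2) ≤ A * (1 + b * s) ^ N := by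
    rw [normFactor, hA, hN, ← Finset.prod_pow_eq_pow_sum, ← Finset.prod_mul_distrib,
      ← Finset.prod_mul_distrib]
    refine Finset.prod_le_prod (fun i _ => mul_nonneg (pow_nonneg (hpos i).le _)
      (momentSeries_nonneg _ _)) fun i _ => ?_
    have h3 := pow_mul_momentSeries_le (k i) (half_pos (hpos i))
    have h4 := (hpos i)
    calc θ i ^ (k i + 1) * momentSeries (k i) (θ i / 2)
        = 2 ^ (k i + 1) * ((θ i / 2) ^ (k i + 1) * momentSeries (k i) (θ i / 2)) := by
          rw [div_pow]; field_simp
      _ ≤ 2 ^ (k i + 1) * (2 * (k i).factorial * (1 + θ i / 2) ^ (k i + 1)) := by gcongr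
      _ ≤ 2 ^ (k i + 1) * (2 * (k i).factorial * (1 + b * s) ^ (k i + 1)) := by
          have := (hθ i).2
          gcongr
          linarith
      _ = _ := by ring
  have hn := normFactor_pos k hpos
  calc normFactor k θ * expSeries nonzeroCoeff k θ
      ≤ normFactor k θ * (Real.exp (-(s / 2)) * ∏ i, momentSeries (k i) (θ i / 2)) := by gcongr
    _ = Real.exp (-(s / 2)) * (normFactor k θ * ∏ i, momentSeries (k i) (θ i / 2)) := by ring
    _ ≤ Real.exp (-(s / 2)) * (A * (1 + b * s) ^ N) := by gcongr
    _ = A * (Real.exp (-(s / 2)) * (1 + b * s) ^ N) := by ring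
    _ ≤ _ := mul_le_mul_of_nonneg_left (exp_neg_half_mul_pow_le hb hs.le N) hA0

/-! ### The asymptotic formula -/

theorem ratioCone_subset (d : ℕ) (ε : ℝ) : ratioCone d ε ⊆ positiveOrthant d := fun _ h => h.1

theorem smul_mem_ratioCone {ε : ℝ} (n : ℕ+) {θ : Fin d → ℝ} (hθ : θ ∈ ratioCone d ε) :
    (n : ℝ) • θ ∈ ratioCone d ε := by
  have hn : (0 : ℝ) < n := by exact_mod_cast n.pos
  refine ⟨fun i => mul_pos hn (hθ.1 i), fun i j hij => ?_⟩
  rw [Pi.smul_apply, Pi.smul_apply, smul_eq_mul, smul_eq_mul, mul_div_mul_left _ _ hn.ne']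
  exact hθ.2 i j hij

theorem exists_bound_ratioCone (hd : d ≠ 0) (k : Fin d → ℕ) {ε : ℝ} (hε : 1 < ε) :
    ∃ C, ∀ θ ∈ ratioCone d ε, normFactor k θ * expSeries nonzeroCoeff k θ ≤ C := by
  have hε0 : 0 < ε := by linarith
  obtain ⟨C, hC⟩ := exists_normFactor_mul_expSeries_le k (b := ε ^ 2) (one_le_pow₀ hε.le)
  refine ⟨C, fun θ hθ => ?_⟩
  let i₀ : Fin d := ⟨0, Nat.pos_of_ne_zero hd⟩
  have h0 : 0 < θ i₀ := hθ.1 i₀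
  -- In the cone every coordinate lies in `[θ i₀ / ε, ε θ i₀]`, and the upper end is `ε²` times the
  -- lower; hence `b = ε ^ 2`.
  refine hC (θ i₀ / ε) θ (by positivity) fun i => ?_
  have e : ε ^ 2 * (θ i₀ / ε) = ε * θ i₀ := by field_simp
  rw [e]
  rcases eq_or_ne i i₀ with rfl | hi
  · exact ⟨div_le_self h0.le hε.le, le_mul_of_one_le_left h0.le hε.le⟩
  · obtain ⟨h1, h2⟩ := hθ.2 i i₀ hi
    rw [lt_div_iff₀ h0] at h1
    rw [div_lt_iff₀ h0] at h2
    exact ⟨by rw [div_eq_inv_mul, ← one_div]; exact h1.le, h2.le⟩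

theorem tendsto_normFactor_mul_expSeries_zonCoeff (hd : 2 ≤ d) (k : Fin d → ℕ) {ε : ℝ}
    (hε : 1 < ε) :
    Tendsto (fun θ => normFactor k θ * expSeries zonCoeff k θ) (𝓝[ratioCone d ε] 0)
      (𝓝 ((riemannZeta ((d : ℂ) + 1)).re / (riemannZeta (d : ℂ)).re *
        (2 ^ (d - 1) * ∏ i, ((k i).factorial : ℝ)))) := by
  have hd0 : d ≠ 0 := by omega
  obtain ⟨C, hC⟩ := exists_bound_ratioCone hd0 k hε
  have hmain := tendsto_tsum_smul_of_tendsto (K := ratioCone d ε)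
    (fun n θ hθ => smul_mem_ratioCone n hθ) (e := d) (by omega)
    (p := fun θ => normFactor k θ * expSeries primitiveCoeff k θ)
    (t := fun θ => normFactor k θ * expSeries nonzeroCoeff k θ) (C := C) ?_ ?_
    (tendsto_normFactor_mul_expSeries (ratioCone_subset d ε) hd0 k)
  · refine hmain.congr' ?_
    filter_upwards [self_mem_nhdsWithin] with θ hθ
    rw [expSeries_eq_tsum_primitive abs_zonCoeff_le zonCoeff_zero
      (b := fun m => (m : ℝ)⁻¹) zonCoeff_dilate k hθ.1, ← tsum_mul_left]
    refine tsum_congr fun m => ?_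
    have hm : (m : ℝ) ≠ 0 := by exact_mod_cast m.ne_zero
    -- The homogeneity degree `|k| + d` of the normalisation cancels `m^{|k|}`, and the weight `1/m`
    -- raises the exponent from `d` to `d + 1`.
    rw [normFactor_smul]
    field_simp
    ring
  · intro θ hθ
    have hn := normFactor_pos k hθ.1
    have h0 : 0 ≤ expSeries primitiveCoeff k θ :=
      tsum_nonneg fun w => mul_nonneg (primitiveCoeff_nonneg w) (expTerm_nonneg _ _ _)
    rw [abs_of_nonneg (by positivity)]
    refine le_trans ?_ (hC θ hθ)
    gcongr
    exact (summable_mul_expTerm abs_primitiveCoeff_le k hθ.1).tsum_le_tsum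
      (fun w => mul_le_mul_of_nonneg_right (primitiveCoeff_le w) (expTerm_nonneg _ _ _))
      (summable_mul_expTerm abs_nonzeroCoeff_le k hθ.1)
  · intro θ hθ
    rw [expSeries_eq_tsum_primitive abs_nonzeroCoeff_le (by simp [nonzeroCoeff])
      (b := fun _ => 1) (fun x => by rw [nonzeroCoeff_dilate, one_mul]) k hθ.1, ← tsum_mul_left]
    refine tsum_congr fun m => ?_
    have hm : (m : ℝ) ≠ 0 := by exact_mod_cast m.ne_zero
    rw [normFactor_smul]
    field_simp
    ring

end LatticeZonotope

open LatticeZonotope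

theorem mainTheorem2 (d : ℕ) (hd : 2 ≤ d) :
    (∀ θ ∈ LatticeZonotope.positiveOrthant d,
      Multipliable fun v : LatticeZonotope.primitiveVectors d =>
        LatticeZonotope.zonFactor (fun i => Real.exp (-θ i)) v) ∧
    ContDiffOn ℝ ∞ (LatticeZonotope.logZonExp d) (LatticeZonotope.positiveOrthant d) ∧
    ∀ (k : Fin d → ℕ) (ε : ℝ), 1 < ε →
      Asymptotics.IsEquivalent (nhdsWithin 0 (LatticeZonotope.ratioCone d ε))
        (LatticeZonotope.mixedPartial k (LatticeZonotope.logZonExp d))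
        (fun θ => (-1) ^ (∑ i, k i) *
          (2 ^ (d - 1) * (riemannZeta ((d : ℂ) + 1)).re / (riemannZeta (d : ℂ)).re) *
          ((∏ i, ((k i).factorial : ℝ)) / ∏ i, θ i ^ (k i + 1))) := by
  refine ⟨fun θ hθ => multipliable_zonFactor hθ,
    (contDiffOn_expSeries abs_zonCoeff_le 0).congr fun θ hθ => logZonExp_eq hθ,
    fun k ε hε => Asymptotics.isEquivalent_of_tendsto_one ?_⟩
  have hz1 : (riemannZeta ((d : ℂ) + 1)).re ≠ 0 := by
    have := (tsum_pnat_inv_pow_pos (e := d + 1) (by omega)).ne'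
    rw [← riemannZeta_re_eq_tsum_pnat (by omega)] at this
    exact_mod_cast this
  have hz : (riemannZeta (d : ℂ)).re ≠ 0 := by
    rw [riemannZeta_re_eq_tsum_pnat (by omega)]
    exact (tsum_pnat_inv_pow_pos (by omega)).ne'
  have hf : (∏ i, ((k i).factorial : ℝ)) ≠ 0 :=
    Finset.prod_ne_zero_iff.2 fun i _ => by exact_mod_cast (k i).factorial_ne_zero
  have h := (tendsto_normFactor_mul_expSeries_zonCoeff hd k hε).div_const
    ((riemannZeta ((d : ℂ) + 1)).re / (riemannZeta (d : ℂ)).re *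
        (2 ^ (d - 1) * ∏ i, ((k i).factorial : ℝ)))
  rw [div_self (by positivity)] at h
  refine h.congr' ?_
  filter_upwards [self_mem_nhdsWithin] with θ hθ
  have h1 := mixedPartial_eq_of_eqOn abs_zonCoeff_le (fun θ hθ => logZonExp_eq hθ) k hθ.1
  have hn := (normFactor_pos k hθ.1).ne'
  rw [Pi.div_apply, h1, ← LatticeZonotope.normFactor]
  have hs : ((-1 : ℝ) ^ (∑ i, k i)) ≠ 0 := pow_ne_zero _ (by norm_num)
  field_simp
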